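/- Let $A$ and $B$ be finite-dimensional quantum systems with fixed orthonormal bases, let $T_B$ denote the partial transpose on $B$, $(|i_Aj_B\rangle\langle k_Al_B|)^{T_B}=|i_Al_B\rangle\langle k_Aj_B|$, and let $\log=\log_2$. A positive semidefinite operator is PPT if its partial transpose is positive semidefinite. A PPT operation is a completely positive trace-preserving map $\Pi$ from operators on $A\otimes B$ to operators on $A'\otimes B'$ whose Choi matrix $\sum_{x,y}|x\rangle\langle y|\otimes\Pi(|x\rangle\langle y|)$ is PPT with respect to the cut $AA':BB'$. For $k\ge 1$ let $\Phi(k)=\frac1k\sum_{i,j=0}^{k-1}|ii\rangle\langle jj|$, and for a bipartite state $\rho$ put $$F_\Gamma(\rho,k)=\sup\{\operatorname{tr}\Phi(k)\,\Pi(\rho):\Pi\text{ a PPT operation into }\mathbb C^k\otimes\mathbb C^k\},\qquad E^{(1)}_{\Gamma,\varepsilon}(\rho)=\log\max\{k\in\mathbb N: k\ge1,\ F_\Gamma(\rho,k)\ge 1-\varepsilon\}\quad(0<\varepsilon<1).$$ The asymptotic PPT-assisted distillable entanglement is $$E_\Gamma(\rho)=\lim_{\varepsilon\to0^+}\limsup_{n\to\infty}\frac1n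 E^{(1)}_{\Gamma,\varepsilon}(\rho^{\otimes n}),$$ where $\rho^{\otimes n}$ is regarded as a bipartite state on $A^{\otimes n}:B^{\otimes n}$. Let $\mathrm{PPT}'(A:B)=\{\sigma\ge0:\|\sigma^{T_B}\|_1\le1\}$ with $\|M\|_1=\operatorname{tr}\sqrt{M^\dagger M}$, and let $D(\rho\|\sigma)=\operatorname{tr}\rho(\log\rho-\log\sigma)$ if $\operatorname{supp}\rho\subseteq\operatorname{supp}\sigma$ and $D(\rho\|\sigma)=+\infty$ otherwise. Then for every bipartite state $\rho$ on $A\otimes B$, $$E_\Gamma(\rho)\le R(\rho):=\min_{\sigma\in\mathrm{PPT}'(A:B)}D(\rho\|\sigma).$$ -/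

import Mathlib

open scoped Matrix ComplexOrder

noncomputable section

namespace Entanglement

/-- A quantum state: a positive semidefinite matrix of trace one. -/
def IsState {I : Type*} [Fintype I] (ρ : Matrix I I ℂ) : Prop :=
  ρ.PosSemidef ∧ ρ.trace = 1

/-- The partial transpose `M ^ T_B` on the second system: it sends
`|i j⟩⟨k l|` to `|i l⟩⟨k j|`. -/
def partialTranspose {A B : Type*} (M : Matrix (A × B) (A × B) ℂ) :
    Matrix (A × B) (A × B) ℂ :=
  Matrix.of fun p q => M (p.1, q.2) (q.1, p.2)

/-- A bipartite operator is PPT if it and its partial transpose are positive semidefinite. -/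
def IsPPT {A B : Type*} (M : Matrix (A × B) (A × B) ℂ) : Prop :=
  M.PosSemidef ∧ (partialTranspose M).PosSemidef

/-- The trace norm `‖M‖₁ = tr √(M† M)`. -/
def traceNorm {I : Type*} [Fintype I] [DecidableEq I] (M : Matrix I I ℂ) : ℝ :=
  (cfc Real.sqrt (Mᴴ * M)).trace.re

/-- The Rains set `PPT'(A:B)`. -/
def rainsSet (A B : Type*) [Fintype A] [DecidableEq A] [Fintype B] [DecidableEq B] :
    Set (Matrix (A × B) (A × B) ℂ) :=
  {M | M.PosSemidef ∧ traceNorm (partialTranspose M) ≤ 1}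

open Classical in
/-- The quantum relative entropy `D(ρ‖σ) = tr ρ (log ρ - log σ)`, with logarithms to base two
taken on the supports (`logb 2 0 = 0`), and `+∞` unless the support of `ρ` is contained in the
support of `σ`, that is, unless `ker σ ⊆ ker ρ`. -/
def relEntropy {I : Type*} [Fintype I] [DecidableEq I] (ρ σ : Matrix I I ℂ) : EReal :=
  if ∀ v : I → ℂ, σ *ᵥ v = 0 → ρ *ᵥ v = 0 then
    (((ρ * (cfc (Real.logb 2) ρ - cfc (Real.logb 2) σ)).trace.re : ℝ) : EReal)
  else ⊤

/-- The Rains bound `R(ρ)`, the least value of `D(ρ‖σ)` over the Rains set. -/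
def rainsBound {A B : Type*} [Fintype A] [DecidableEq A] [Fintype B] [DecidableEq B]
    (ρ : Matrix (A × B) (A × B) ℂ) : EReal :=
  ⨅ σ ∈ rainsSet A B, relEntropy ρ σ

/-- `id_m ⊗ N`, applied to an operator on `ℂ^m ⊗ ℂ^I`: `N` acts on each block. -/
def ampliation {I J : Type*} (N : Matrix I I ℂ →ₗ[ℂ] Matrix J J ℂ) (m : ℕ)
    (X : Matrix (Fin m × I) (Fin m × I) ℂ) : Matrix (Fin m × J) (Fin m × J) ℂ :=
  Matrix.of fun p q => N (Matrix.of fun x y => X (p.1, x) (q.1, y)) p.2 q.2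

/-- A quantum channel: a completely positive and trace-preserving linear map. -/
def IsChannel {I J : Type*} [Fintype I] [Fintype J]
    (N : Matrix I I ℂ →ₗ[ℂ] Matrix J J ℂ) : Prop :=
  (∀ (m : ℕ) (X : Matrix (Fin m × I) (Fin m × I) ℂ),
      X.PosSemidef → (ampliation N m X).PosSemidef) ∧
    ∀ X : Matrix I I ℂ, (N X).trace = X.trace

/-- The Choi matrix `∑ |x⟩⟨y| ⊗ N(|x⟩⟨y|)` (`x`, `y` over the product basis of the input `AB`)
of a bipartite map from `AB` to `A'B'`, with the four systems regrouped as `AA' : BB'`. -/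
def choi {A B A' B' : Type*} [DecidableEq A] [DecidableEq B]
    (N : Matrix (A × B) (A × B) ℂ →ₗ[ℂ] Matrix (A' × B') (A' × B') ℂ) :
    Matrix ((A × A') × (B × B')) ((A × A') × (B × B')) ℂ :=
  Matrix.of fun p q =>
    N (Matrix.single (p.1.1, p.2.1) (q.1.1, q.2.1) 1) (p.1.2, p.2.2) (q.1.2, q.2.2)

/-- A PPT operation: a bipartite quantum channel whose Choi matrix is PPT in the cut
`AA' : BB'`. -/
def IsPPTOperation {A B A' B' : Type*} [Fintype A] [DecidableEq A] [Fintype B] [DecidableEq B]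
    [Fintype A'] [Fintype B']
    (N : Matrix (A × B) (A × B) ℂ →ₗ[ℂ] Matrix (A' × B') (A' × B') ℂ) : Prop :=
  IsChannel N ∧ IsPPT (choi N)

/-- The maximally entangled state `Φ(k) = (1/k) ∑ |i i⟩⟨j j|`. -/
def maxEntangled (k : ℕ) : Matrix (Fin k × Fin k) (Fin k × Fin k) ℂ :=
  Matrix.of fun p q => if p.1 = p.2 ∧ q.1 = q.2 then (1 / k : ℂ) else 0

/-- The fidelity of `k`-state PPT distillation, `F_Γ(ρ, k)`. -/
def pptFidelity {A B : Type*} [Fintype A] [DecidableEq A] [Fintype B] [DecidableEq B]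
    (ρ : Matrix (A × B) (A × B) ℂ) (k : ℕ) : ℝ :=
  sSup {f : ℝ | ∃ N : Matrix (A × B) (A × B) ℂ →ₗ[ℂ] Matrix (Fin k × Fin k) (Fin k × Fin k) ℂ,
    IsPPTOperation N ∧ f = (maxEntangled k * N ρ).trace.re}

/-- The one-shot `ε`-infidelity PPT-assisted distillable entanglement
`log max {k : F_Γ(ρ, k) ≥ 1 - ε}`, with the logarithm to base two. -/
def oneShotDistillable {A B : Type*} [Fintype A] [DecidableEq A] [Fintype B] [DecidableEq B]
    (ε : ℝ) (ρ : Matrix (A × B) (A × B) ℂ) : EReal :=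
  ⨆ k ∈ {k : ℕ | 1 ≤ k ∧ 1 - ε ≤ pptFidelity ρ k}, ((Real.logb 2 k : ℝ) : EReal)

/-- The `n`-fold tensor power `ρ^{⊗ n}` as an operator on the bipartite system `A^n : B^n`. -/
def tensorPower {A B : Type*} (ρ : Matrix (A × B) (A × B) ℂ) (n : ℕ) :
    Matrix ((Fin n → A) × (Fin n → B)) ((Fin n → A) × (Fin n → B)) ℂ :=
  Matrix.of fun p q => ∏ i, ρ (p.1 i, p.2 i) (q.1 i, q.2 i)

/-- The asymptotic PPT-assisted distillable entanglement: the limit for `ε → 0+` of the upper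
limit for `n → ∞` of `(1/n) log max {k : F_Γ(ρ^{⊗ n}, k) ≥ 1 - ε}`. The inner expression is
nondecreasing in `ε`, so the outer upper limit is a limit. -/
def pptDistillable {A B : Type*} [Fintype A] [DecidableEq A] [Fintype B] [DecidableEq B]
    (ρ : Matrix (A × B) (A × B) ℂ) : EReal :=
  Filter.limsup (fun ε : ℝ =>
    Filter.limsup (fun n : ℕ => oneShotDistillable ε (tensorPower ρ n) / (n : EReal))
      Filter.atTop) (nhdsWithin 0 (Set.Ioi 0))

end Entanglement

end

namespace Entanglement

/-! A PPT operation aiming at `Φ(k)` yields a hypothesis test: the effect T = N†(Φ(k)) accepts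
ρ^{⊗n} with probability equal to the fidelity. It accepts σ^{⊗n}, for σ in the Rains set, with
probability at most 1/k. Indeed kΦ(k)^Γ is the swap, Γ∘N∘Γ is positive and trace preserving, and
‖(σ^{⊗n})^Γ‖₁ = ‖σ^Γ‖₁^n ≤ 1 (`trace_maxEntangled_pptOperation_le`).

The test is made classical through the weights a_j|⟨x_j|y_l⟩|² and b_l|⟨x_j|y_l⟩|² built from the
spectral data of ρ and σ. Their minimum bounds the test errors from below
(`sum_min_le_test_errors`), they factorize over tensor powers, and their relative entropy is D(ρ‖σ)
(`relEntropy_eq_sum`). For R > D(ρ‖σ), a Chernoff bound with threshold 2^{nR}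
(`one_sub_pow_le_sum_min`, `exists_sum_rpow_lt_exp`) gives 1 - q^n ≤ 2(1 - F + 2^{nR}/k) with q < 1.
Hence log k ≤ nR + 3 eventually, whenever ε < 1/4. -/

/-- The operator `∑ j, d j |u_j⟩⟨u_j|`, where `u_j` are the columns of `U`. -/
noncomputable def spectralMatrix {I J : Type*} [Fintype J] [DecidableEq J] (U : Matrix I J ℂ)
    (d : J → ℝ) : Matrix I I ℂ :=
  U * Matrix.diagonal (fun j => (d j : ℂ)) * Uᴴ

lemma spectralMatrix_apply {I J : Type*} [Fintype J] [DecidableEq J] (U : Matrix I J ℂ)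
    (d : J → ℝ) (p q : I) :
    spectralMatrix U d p q = ∑ j, (d j : ℂ) * (U p j * star (U q j)) := by
  rw [spectralMatrix, Matrix.mul_apply]
  simp only [Matrix.mul_diagonal, Matrix.conjTranspose_apply]
  exact Finset.sum_congr rfl fun j _ => by ring

lemma exists_spectralMatrix {I : Type*} [Fintype I] [DecidableEq I] {M : Matrix I I ℂ}
    (hM : M.IsHermitian) :
    ∃ (U : Matrix I I ℂ) (d : I → ℝ), U * Uᴴ = 1 ∧ Uᴴ * U = 1 ∧ M = spectralMatrix U d ∧
      (∀ f : ℝ → ℝ, cfc f M = spectralMatrix U (fun i => f (d i))) ∧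
      (M.PosSemidef → ∀ i, 0 ≤ d i) := by
  refine ⟨hM.eigenvectorUnitary, hM.eigenvalues, ?_, ?_, ?_, fun f => ?_,
    fun h => h.eigenvalues_nonneg⟩
  · exact Unitary.coe_mul_star_self _
  · exact Unitary.coe_star_mul_self _
  · conv_lhs => rw [hM.spectral_theorem]
    rfl
  · rw [hM.cfc_eq]
    rfl

lemma trace_mul_spectralMatrix {I J : Type*} [Fintype I] [Fintype J] [DecidableEq J]
    (S : Matrix I I ℂ) (U : Matrix I J ℂ) (d : J → ℝ) :
    (S * spectralMatrix U d).trace.re = ∑ j, d j * ((Uᴴ * S * U) j j).re := by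
  have : (S * spectralMatrix U d).trace
      = (Uᴴ * S * U * Matrix.diagonal (fun j => (d j : ℂ))).trace := by
    rw [spectralMatrix, ← Matrix.mul_assoc, Matrix.trace_mul_comm]
    simp only [Matrix.mul_assoc]
  rw [this, Matrix.trace, Complex.re_sum]
  refine Finset.sum_congr rfl fun j _ => ?_
  rw [Matrix.diag_apply, Matrix.mul_diagonal, Complex.re_mul_ofReal, mul_comm]

lemma mul_conjTranspose_apply_self_re {J K : Type*} [Fintype K] (Z : Matrix J K ℂ) (j : J) :
    ((Z * Zᴴ) j j).re = ∑ k, Complex.normSq (Z j k) := by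
  rw [Matrix.mul_apply, Complex.re_sum]
  refine Finset.sum_congr rfl fun k _ => ?_
  rw [Matrix.conjTranspose_apply, Complex.star_def, Complex.mul_conj, Complex.ofReal_re]

lemma trace_spectralMatrix {I J : Type*} [Fintype I] [Fintype J] [DecidableEq I] [DecidableEq J]
    {U : Matrix I J ℂ} (hU : Uᴴ * U = 1) (d : J → ℝ) :
    (spectralMatrix U d).trace.re = ∑ j, d j := by
  have := trace_mul_spectralMatrix 1 U d
  rw [one_mul] at this
  simp [this, hU]

/-- The overlap `tr (X a X†)(Y b Y†)`. -/
lemma trace_spectralMatrix_mul {I J K : Type*} [Fintype I] [Fintype J] [Fintype K]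
    [DecidableEq J] [DecidableEq K] (X : Matrix I J ℂ) (Y : Matrix I K ℂ)
    (a : J → ℝ) (b : K → ℝ) :
    (spectralMatrix X a * spectralMatrix Y b).trace.re
      = ∑ j, ∑ k, a j * b k * Complex.normSq ((Xᴴ * Y) j k) := by
  rw [Matrix.trace_mul_comm, trace_mul_spectralMatrix]
  refine Finset.sum_congr rfl fun j _ => ?_
  have h : Xᴴ * spectralMatrix Y b * X = spectralMatrix (Xᴴ * Y) b := by
    simp only [spectralMatrix, Matrix.conjTranspose_mul, Matrix.conjTranspose_conjTranspose,
      Matrix.mul_assoc]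
  rw [h, spectralMatrix_apply, Complex.re_sum, Finset.mul_sum]
  refine Finset.sum_congr rfl fun k _ => ?_
  rw [Complex.star_def, Complex.mul_conj, ← Complex.ofReal_mul, Complex.ofReal_re, mul_assoc]

/-! ### Errors of a quantum test -/

/-- S - S² = S(1 - S)S + (1 - S)S(1 - S). -/
lemma posSemidef_sub_mul_self {I : Type*} [Fintype I] [DecidableEq I] {S : Matrix I I ℂ}
    (hS : S.PosSemidef) (hS1 : (1 - S).PosSemidef) : (S - S * S).PosSemidef := by
  have h1 := hS1.mul_mul_conjTranspose_same S
  have h2 := hS.mul_mul_conjTranspose_same (1 - S)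
  rw [hS.isHermitian.eq] at h1
  rw [hS1.isHermitian.eq] at h2
  convert h1.add h2 using 1
  noncomm_ring

/-- The columns of Y resolve the identity, so the inner sum is ⟨x_j|S²|x_j⟩, and S² ≤ S. -/
lemma sum_normSq_le_trace_mul {I J K : Type*} [Fintype I] [DecidableEq I] [Fintype J] [Fintype K]
    [DecidableEq J] {S : Matrix I I ℂ} (hS : S.PosSemidef)
    (hS1 : (1 - S).PosSemidef) (X : Matrix I J ℂ) {Y : Matrix I K ℂ} (hY : Y * Yᴴ = 1)
    {a : J → ℝ} (ha : ∀ j, 0 ≤ a j) :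
    ∑ j, a j * ∑ k, Complex.normSq ((Xᴴ * S * Y) j k) ≤ (S * spectralMatrix X a).trace.re := by
  rw [trace_mul_spectralMatrix]
  refine Finset.sum_le_sum fun j _ => mul_le_mul_of_nonneg_left ?_ (ha j)
  rw [← mul_conjTranspose_apply_self_re]
  have h1 : Xᴴ * S * Y * (Xᴴ * S * Y)ᴴ = Xᴴ * (S * S) * X := by
    rw [Matrix.conjTranspose_mul, Matrix.conjTranspose_mul, Matrix.conjTranspose_conjTranspose,
      hS.isHermitian.eq]
    calc Xᴴ * S * Y * (Yᴴ * (S * X)) = Xᴴ * S * (Y * Yᴴ) * (S * X) := by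
          simp only [Matrix.mul_assoc]
      _ = _ := by rw [hY]; simp only [Matrix.mul_assoc, Matrix.one_mul]
  have h2 := ((posSemidef_sub_mul_self hS hS1).conjTranspose_mul_mul_same X).diag_nonneg (i := j)
  rw [Matrix.mul_sub, Matrix.sub_mul, Matrix.sub_apply] at h2
  have h3 := (Complex.le_def.1 h2).1
  rw [Complex.zero_re, Complex.sub_re] at h3
  rw [h1]
  linarith

/-- The Nussbaum–Szkoła lower bound on the sum of the two error probabilities of a test. -/
lemma sum_min_le_test_errors {I J K : Type*} [Fintype I] [DecidableEq I] [Fintype J]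
    [DecidableEq J] [Fintype K] [DecidableEq K]
    {T : Matrix I I ℂ} (hT : T.PosSemidef) (hT1 : (1 - T).PosSemidef)
    {X : Matrix I J ℂ} {Y : Matrix I K ℂ} (hX : X * Xᴴ = 1) (hY : Y * Yᴴ = 1)
    {a : J → ℝ} {b : K → ℝ} (ha : ∀ j, 0 ≤ a j) (hb : ∀ k, 0 ≤ b k) :
    ∑ j, ∑ k, min (a j) (b k) * Complex.normSq ((Xᴴ * Y) j k)
      ≤ 2 * (((1 - T) * spectralMatrix X a).trace.re + (T * spectralMatrix Y b).trace.re) := by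
  have h1 := sum_normSq_le_trace_mul hT1 (by rwa [sub_sub_cancel]) X hY ha
  have h2 := sum_normSq_le_trace_mul hT hT1 Y hX hb
  simp only [Finset.mul_sum] at h1 h2
  rw [Finset.sum_comm] at h2
  have h3 : ∀ j k, Complex.normSq ((Yᴴ * T * X) k j) = Complex.normSq ((Xᴴ * T * Y) j k) := by
    intro j k
    have : Yᴴ * T * X = (Xᴴ * T * Y)ᴴ := by
      simp only [Matrix.conjTranspose_mul, Matrix.conjTranspose_conjTranspose, hT.isHermitian.eq,
        Matrix.mul_assoc]
    rw [this, Matrix.conjTranspose_apply, Complex.star_def, Complex.normSq_conj]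
  simp only [h3] at h2
  refine le_trans ?_ (mul_le_mul_of_nonneg_left (add_le_add h1 h2) zero_le_two)
  simp only [← Finset.sum_add_distrib, Finset.mul_sum]
  refine Finset.sum_le_sum fun j _ => Finset.sum_le_sum fun k _ => ?_
  -- Splitting each overlap by 1 = (1 - T) + T gives one term per error; |u + v|² ≤ 2(|u|² + |v|²)
  -- is the source of the factor 2.
  have h4 : (Xᴴ * Y) j k = (Xᴴ * (1 - T) * Y : Matrix J K ℂ) j k + (Xᴴ * T * Y) j k := by
    rw [← Matrix.add_apply]
    rw [Matrix.mul_sub, Matrix.sub_mul, Matrix.mul_one, sub_add_cancel]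
  set u := (Xᴴ * (1 - T) * Y : Matrix J K ℂ) j k
  set v := (Xᴴ * T * Y) j k
  have h5 : Complex.normSq (u + v) ≤ 2 * (Complex.normSq u + Complex.normSq v) := by
    simp only [Complex.normSq_apply, Complex.add_re, Complex.add_im]
    nlinarith [sq_nonneg (u.re - v.re), sq_nonneg (u.im - v.im)]
  rw [h4]
  have hu := Complex.normSq_nonneg u
  have hv := Complex.normSq_nonneg v
  calc min (a j) (b k) * Complex.normSq (u + v)
      ≤ min (a j) (b k) * (2 * (Complex.normSq u + Complex.normSq v)) :=
        mul_le_mul_of_nonneg_left h5 (le_min (ha j) (hb k))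
    _ = 2 * (min (a j) (b k) * Complex.normSq u + min (a j) (b k) * Complex.normSq v) := by ring
    _ ≤ _ := by gcongr <;> simp

/-- The trace norm of a Hermitian operator is the sum of the moduli of its eigenvalues. -/
lemma exists_spectralMatrix_traceNorm {I : Type*} [Fintype I] [DecidableEq I] {M : Matrix I I ℂ}
    (hM : M.IsHermitian) :
    ∃ (U : Matrix I I ℂ) (d : I → ℝ), U * Uᴴ = 1 ∧ Uᴴ * U = 1 ∧ M = spectralMatrix U d ∧
      traceNorm M = ∑ i, |d i| := by
  obtain ⟨U, d, h1, h2, h3, h4, -⟩ := exists_spectralMatrix hM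
  refine ⟨U, d, h1, h2, h3, ?_⟩
  have hsa : IsSelfAdjoint M := hM
  have : cfc Real.sqrt (Mᴴ * M) = cfc (fun x : ℝ => |x|) M := by
    have hsq : Mᴴ * M = cfc (fun x : ℝ => x ^ 2) M := by
      rw [cfc_pow_id M 2, hM.eq, pow_two]
    rw [hsq, ← cfc_comp' Real.sqrt (fun x : ℝ => x ^ 2) M]
    simp only [Real.sqrt_sq_eq_abs]
  rw [traceNorm, this, h4, trace_spectralMatrix h2]

/-! ### Spectral data of tensor powers -/

/-- Tensor products of the columns of `U`, as vectors of the bipartite system `A^n : B^n`. -/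
noncomputable def powBasis {A B J : Type*} (U : Matrix (A × B) J ℂ) (n : ℕ) :
    Matrix ((Fin n → A) × (Fin n → B)) (Fin n → J) ℂ :=
  Matrix.of fun p f => ∏ i, U (p.1 i, p.2 i) (f i)

lemma powBasis_mul_conjTranspose {A B J : Type*} [DecidableEq A] [DecidableEq B] [Fintype J]
    [DecidableEq J] {U : Matrix (A × B) J ℂ} (hU : U * Uᴴ = 1) (n : ℕ) :
    powBasis U n * (powBasis U n)ᴴ = 1 := by
  ext p q
  have h1 : (powBasis U n * (powBasis U n)ᴴ) p q
      = ∏ i, (U * Uᴴ) (p.1 i, p.2 i) (q.1 i, q.2 i) := by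
    simp only [Matrix.mul_apply, Matrix.conjTranspose_apply, powBasis, Matrix.of_apply,
      Fintype.prod_sum, star_prod, Finset.prod_mul_distrib]
  rw [h1, hU]
  by_cases h : p = q
  · rw [h, Matrix.one_apply_eq]
    exact Finset.prod_eq_one fun i _ => Matrix.one_apply_eq _
  · rw [Matrix.one_apply_ne h]
    obtain ⟨i, hi⟩ : ∃ i, (p.1 i, p.2 i) ≠ (q.1 i, q.2 i) := by
      by_contra! hc
      exact h (Prod.ext (funext fun i => congrArg Prod.fst (hc i))
        (funext fun i => congrArg Prod.snd (hc i)))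
    exact Finset.prod_eq_zero (Finset.mem_univ i) (Matrix.one_apply_ne hi)

lemma conjTranspose_powBasis_mul_apply {A B J K : Type*} [Fintype A] [Fintype B]
    (U : Matrix (A × B) J ℂ) (V : Matrix (A × B) K ℂ) (n : ℕ) (f : Fin n → J) (g : Fin n → K) :
    ((powBasis U n)ᴴ * powBasis V n) f g = ∏ i, (Uᴴ * V) (f i) (g i) := by
  classical
  simp only [Matrix.mul_apply, Matrix.conjTranspose_apply, powBasis, Matrix.of_apply,
    Fintype.prod_sum, star_prod, ← Finset.prod_mul_distrib]
  exact (Fintype.sum_equiv (Equiv.arrowProdEquivProdArrow (Fin n) (fun _ => A) (fun _ => B))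
    _ _ fun x => rfl).symm

lemma conjTranspose_powBasis_mul {A B J : Type*} [Fintype A] [Fintype B] [DecidableEq J]
    {U : Matrix (A × B) J ℂ} (hU : Uᴴ * U = 1) (n : ℕ) :
    (powBasis U n)ᴴ * powBasis U n = 1 := by
  ext f g
  rw [conjTranspose_powBasis_mul_apply, hU]
  by_cases h : f = g
  · rw [h, Matrix.one_apply_eq]
    exact Finset.prod_eq_one fun i _ => Matrix.one_apply_eq _
  · rw [Matrix.one_apply_ne h]
    obtain ⟨i, hi⟩ := Function.ne_iff.1 h
    exact Finset.prod_eq_zero (Finset.mem_univ i) (Matrix.one_apply_ne hi)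

lemma tensorPower_spectralMatrix {A B J : Type*} [Fintype J] [DecidableEq J]
    (U : Matrix (A × B) J ℂ) (d : J → ℝ) (n : ℕ) :
    tensorPower (spectralMatrix U d) n
      = spectralMatrix (powBasis U n) (fun f => ∏ i, d (f i)) := by
  ext p q
  simp only [tensorPower, Matrix.of_apply, spectralMatrix_apply, powBasis, Fintype.prod_sum,
    star_prod, Finset.prod_mul_distrib, Complex.ofReal_prod]

lemma partialTranspose_tensorPower {A B : Type*} (M : Matrix (A × B) (A × B) ℂ) (n : ℕ) :
    partialTranspose (tensorPower M n) = tensorPower (partialTranspose M) n := rfl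

/-! ### PPT operations and the maximally entangled state -/

lemma maxEntangled_isHermitian (k : ℕ) : (maxEntangled k).IsHermitian := by
  ext p q
  simp only [Matrix.conjTranspose_apply, maxEntangled, Matrix.of_apply, and_comm (a := q.1 = q.2)]
  split_ifs <;> simp

lemma maxEntangled_mul_self (k : ℕ) : maxEntangled k * maxEntangled k = maxEntangled k := by
  ext p q
  rw [Matrix.mul_apply, Fintype.sum_prod_type]
  simp only [maxEntangled, Matrix.of_apply]
  by_cases hp : p.1 = p.2 <;> by_cases hq : q.1 = q.2 <;> simp [hp, hq]
  have : (k : ℂ) ≠ 0 := by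
    have := p.1.pos
    exact_mod_cast this.ne'
  field_simp

lemma maxEntangled_eq_conjTranspose_mul_self (k : ℕ) :
    maxEntangled k = (maxEntangled k)ᴴ * maxEntangled k := by
  rw [(maxEntangled_isHermitian k).eq, maxEntangled_mul_self]

lemma one_sub_maxEntangled_eq_conjTranspose_mul_self (k : ℕ) :
    1 - maxEntangled k = (1 - maxEntangled k)ᴴ * (1 - maxEntangled k) := by
  rw [Matrix.conjTranspose_sub, (maxEntangled_isHermitian k).eq, Matrix.conjTranspose_one,
    Matrix.mul_sub, Matrix.sub_mul, Matrix.sub_mul, maxEntangled_mul_self]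
  simp

/-- The effect `N†(S)` on the input, where the map `N` acts on matrix units. -/
def adjointEffect {I J : Type*} [Fintype J] [DecidableEq I]
    (N : Matrix I I ℂ →ₗ[ℂ] Matrix J J ℂ) (S : Matrix J J ℂ) : Matrix I I ℂ :=
  Matrix.of fun q p => (S * N (Matrix.single p q 1)).trace

lemma trace_adjointEffect_mul {I J : Type*} [Fintype I] [Fintype J] [DecidableEq I]
    (N : Matrix I I ℂ →ₗ[ℂ] Matrix J J ℂ) (S : Matrix J J ℂ) (M : Matrix I I ℂ) :
    (adjointEffect N S * M).trace = (S * N M).trace := by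
  conv_rhs => rw [Matrix.matrix_eq_sum_single M]
  have h : ∀ p q, Matrix.single p q (M p q) = M p q • Matrix.single p q (1 : ℂ) := by
    intro p q
    rw [Matrix.smul_single, smul_eq_mul, mul_one]
  simp only [h, map_sum, map_smul, Matrix.mul_sum, Matrix.trace_sum, Matrix.mul_smul,
    Matrix.trace_smul, smul_eq_mul]
  rw [Matrix.trace, Finset.sum_comm]
  simp only [Matrix.diag_apply, Matrix.mul_apply, adjointEffect, Matrix.of_apply, mul_comm]

lemma adjointEffect_one_sub {I J : Type*} [Fintype I] [Fintype J] [DecidableEq I] [DecidableEq J]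
    {N : Matrix I I ℂ →ₗ[ℂ] Matrix J J ℂ} (hN : IsChannel N) (S : Matrix J J ℂ) :
    adjointEffect N (1 - S) = 1 - adjointEffect N S := by
  ext q p
  rw [Matrix.sub_apply]
  simp only [adjointEffect, Matrix.of_apply, Matrix.sub_mul, Matrix.trace_sub, Matrix.one_mul]
  rw [hN.2]
  by_cases h : p = q
  · rw [h, Matrix.trace_single_eq_same, Matrix.one_apply_eq]
  · simp [Matrix.trace_single_eq_of_ne _ _ _ h, Matrix.one_apply_ne (Ne.symm h)]

/-- Compression of C by v̄ ⊗ 1. Applied to a Choi matrix it contracts either the output, giving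
effects, or the input, giving images of pure states. -/
lemma posSemidef_sum_mul_star {K L : Type*} [Fintype K] [Fintype L] [DecidableEq L]
    {C : Matrix (K × L) (K × L) ℂ} (hC : C.PosSemidef) (v : K → ℂ) :
    (Matrix.of fun x y => ∑ r, ∑ s, v r * C (r, x) (s, y) * star (v s)).PosSemidef := by
  let S : Matrix (K × L) L ℂ := Matrix.of fun r x => if r.2 = x then star (v r.1) else 0
  convert hC.conjTranspose_mul_mul_same S using 1
  ext x y
  simp only [Matrix.of_apply, Matrix.mul_apply, Matrix.conjTranspose_apply, S,
    Fintype.sum_prod_type, apply_ite (star : ℂ → ℂ), star_star, star_zero, ite_mul, zero_mul,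
    mul_ite, mul_zero, Finset.sum_ite_eq', Finset.mem_univ, if_true, Finset.sum_mul]
  exact Finset.sum_comm

/-- The Choi matrix with the systems ordered as input and output. -/
lemma choi_inputOutput_posSemidef {A B A' B' : Type*}
    {C : Matrix ((A × A') × (B × B')) ((A × A') × (B × B')) ℂ} (hC : C.PosSemidef) :
    (C.submatrix (fun r : (A × B) × (A' × B') => ((r.1.1, r.2.1), (r.1.2, r.2.2)))
      (fun r => ((r.1.1, r.2.1), (r.1.2, r.2.2)))).PosSemidef :=
  hC.submatrix _

lemma adjointEffect_posSemidef {A B A' B' : Type*} [Fintype A] [DecidableEq A] [Fintype B]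
    [DecidableEq B] [Fintype A'] [Fintype B']
    {N : Matrix (A × B) (A × B) ℂ →ₗ[ℂ] Matrix (A' × B') (A' × B') ℂ}
    (hN : (choi N).PosSemidef) (R : Matrix (A' × B') (A' × B') ℂ) :
    (adjointEffect N (Rᴴ * R)).PosSemidef := by
  classical
  rw [← Matrix.posSemidef_transpose_iff]
  -- The transposed effect is the Choi matrix with its output contracted against each row of R; the
  -- swap puts the output first.
  have h := Matrix.posSemidef_sum Finset.univ fun z _ => posSemidef_sum_mul_star
    ((choi_inputOutput_posSemidef hN).submatrix Prod.swap) (R z)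
  refine (congrArg Matrix.PosSemidef ?_).mpr h
  ext p q
  simp only [adjointEffect, Matrix.transpose_apply, Matrix.of_apply, Matrix.sum_apply,
    Matrix.trace, Matrix.diag_apply, Matrix.mul_apply, Matrix.conjTranspose_apply,
    Matrix.submatrix_apply, Prod.swap, choi, Finset.sum_mul]
  rw [Finset.sum_comm]
  conv_rhs => rw [Finset.sum_comm]
  refine Finset.sum_congr rfl fun r _ => ?_
  conv_rhs => rw [Finset.sum_comm]
  exact Finset.sum_congr rfl fun s _ => Finset.sum_congr rfl fun z _ => by ring

/-- The overlap of a positive operator with the swap operator is at most its trace. -/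
lemma abs_sum_swap_le_trace {K : Type*} [Fintype K] [DecidableEq K]
    {X : Matrix (K × K) (K × K) ℂ} (hX : X.PosSemidef) :
    |∑ p : K × K, (X p p.swap).re| ≤ X.trace.re := by
  have key : ∀ s : ℝ, s * s = 1 →
      0 ≤ X.trace.re + s * ∑ p : K × K, (X p p.swap).re := by
    intro s hs
    have h1 : ∀ p : K × K, 0 ≤ (X p p).re + (X p.swap p.swap).re
        + s * ((X p p.swap).re + (X p.swap p).re) := by
      intro p
      -- Positivity at e_p + s e_{swap p}, for s = ±1; the submatrix form also covers p = swap p.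
      have h := (hX.submatrix ![p, p.swap]).dotProduct_mulVec_nonneg ![1, (s : ℂ)]
      have h := (Complex.le_def.1 h).1
      simp [Matrix.mulVec, dotProduct, Fin.sum_univ_two] at h
      linear_combination h + (X p.swap p.swap).re * hs
    have h2 := Finset.sum_nonneg fun p (_ : p ∈ Finset.univ) => h1 p
    have h3 : ∑ p : K × K, (X p.swap p.swap).re = ∑ p : K × K, (X p p).re :=
      Fintype.sum_equiv (Equiv.prodComm K K) _ _ fun p => rfl
    have h4 : ∑ p : K × K, (X p.swap p).re = ∑ p : K × K, (X p p.swap).re :=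
      Fintype.sum_equiv (Equiv.prodComm K K) _ _ fun p => rfl
    rw [Finset.sum_add_distrib, Finset.sum_add_distrib, ← Finset.mul_sum,
      Finset.sum_add_distrib, h3, h4] at h2
    rw [Matrix.trace, Complex.re_sum]
    simp only [Matrix.diag_apply]
    linarith
  rw [abs_le]
  have h1 := key 1 (by norm_num)
  have h2 := key (-1) (by norm_num)
  constructor <;> linarith

/-- The partially transposed operation `Γ ∘ N ∘ Γ` is positive. -/
lemma partialTranspose_conj_posSemidef {A B A' B' : Type*} [Fintype A] [DecidableEq A] [Fintype B]
    [DecidableEq B] [Fintype A'] [Fintype B'] [DecidableEq A'] [DecidableEq B']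
    {N : Matrix (A × B) (A × B) ℂ →ₗ[ℂ] Matrix (A' × B') (A' × B') ℂ}
    (hN : (partialTranspose (choi N)).PosSemidef) (w : A × B → ℂ) :
    (partialTranspose (N (partialTranspose (Matrix.vecMulVec w (star w))))).PosSemidef := by
  convert posSemidef_sum_mul_star (choi_inputOutput_posSemidef hN) w using 1
  have hN' : ∀ M : Matrix (A × B) (A × B) ℂ, N M
      = ∑ r, ∑ s, M r s • N (Matrix.single r s 1) := by
    intro M
    conv_lhs => rw [Matrix.matrix_eq_sum_single M]
    simp only [map_sum, ← map_smul, Matrix.smul_single, smul_eq_mul, mul_one]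
  ext x y
  rw [partialTranspose, Matrix.of_apply, hN']
  simp only [Matrix.sum_apply, Matrix.smul_apply, partialTranspose, Matrix.of_apply,
    Matrix.vecMulVec_apply, Pi.star_apply, Matrix.submatrix_apply, choi, smul_eq_mul,
    ← Fintype.sum_prod_type']
  -- The partial transpose on the input, as an exchange of the two B indices.
  let e : (A × B) × (A × B) ≃ (A × B) × (A × B) :=
    ⟨fun r => ((r.1.1, r.2.2), (r.2.1, r.1.2)), fun r => ((r.1.1, r.2.2), (r.2.1, r.1.2)),
      fun r => rfl, fun r => rfl⟩
  exact Fintype.sum_equiv e _ _ fun r => by simp only [e, Equiv.coe_fn_mk]; ring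

lemma trace_partialTranspose {A B : Type*} [Fintype A] [Fintype B]
    (M : Matrix (A × B) (A × B) ℂ) : (partialTranspose M).trace = M.trace := rfl

/-- kΦ(k)^Γ is the swap, and Γ may be moved across the trace pairing. -/
lemma trace_maxEntangled_mul {k : ℕ} (Y : Matrix (Fin k × Fin k) (Fin k × Fin k) ℂ) :
    (maxEntangled k * Y).trace.re
      = (1 / k : ℝ) * ∑ p : Fin k × Fin k, (partialTranspose Y p p.swap).re := by
  have h : (maxEntangled k * Y).trace = (1 / k : ℂ) * ∑ p, partialTranspose Y p p.swap := by
    simp only [Matrix.trace, Matrix.diag_apply, Matrix.mul_apply, maxEntangled, Matrix.of_apply,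
      Fintype.sum_prod_type, partialTranspose, Prod.swap, ite_and, ite_mul, zero_mul,
      Finset.sum_ite_eq, Finset.mem_univ, if_true, Finset.sum_const_zero, Finset.mul_sum,
      Finset.sum_ite_irrel]
    exact Finset.sum_comm
  rw [h, ← Complex.re_sum]
  have : (1 / k : ℂ) = ((1 / k : ℝ) : ℂ) := by push_cast; rfl
  rw [this, Complex.re_ofReal_mul]

lemma partialTranspose_partialTranspose {A B : Type*} (M : Matrix (A × B) (A × B) ℂ) :
    partialTranspose (partialTranspose M) = M := rfl

/-- A Hermitian operator has overlap at most `‖M^Γ‖₁ / k` with `Φ(k)` after a PPT operation. -/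
lemma trace_maxEntangled_pptOperation_le {A B J : Type*} [Fintype A] [DecidableEq A] [Fintype B]
    [DecidableEq B] [Fintype J] [DecidableEq J] {k : ℕ}
    {N : Matrix (A × B) (A × B) ℂ →ₗ[ℂ] Matrix (Fin k × Fin k) (Fin k × Fin k) ℂ}
    (hN : IsPPTOperation N) {M : Matrix (A × B) (A × B) ℂ} {W : Matrix (A × B) J ℂ}
    (hW : Wᴴ * W = 1) {d : J → ℝ} (hM : partialTranspose M = spectralMatrix W d) :
    (maxEntangled k * N M).trace.re ≤ (1 / k : ℝ) * ∑ j, |d j| := by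
  let Z : J → Matrix (A × B) (A × B) ℂ := fun j =>
    partialTranspose (Matrix.vecMulVec (fun p => W p j) (star fun p => W p j))
  have hM' : M = ∑ j, (d j : ℂ) • Z j := by
    rw [← partialTranspose_partialTranspose M, hM]
    ext p q
    simp only [partialTranspose, Matrix.of_apply, spectralMatrix_apply, Matrix.sum_apply,
      Matrix.smul_apply, Z, Matrix.vecMulVec_apply, Pi.star_apply, smul_eq_mul]
  -- Γ∘N∘Γ sends an eigenprojection of M^Γ to a positive operator of trace one, whose swap overlap
  -- is at most 1 in modulus.
  have hZ : ∀ j, |(maxEntangled k * N (Z j)).trace.re| ≤ 1 / k := by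
    intro j
    have h1 := abs_sum_swap_le_trace
      (partialTranspose_conj_posSemidef hN.2.2 (fun p => W p j))
    have h2 : (partialTranspose (N (Z j))).trace = 1 := by
      rw [trace_partialTranspose, hN.1.2, trace_partialTranspose]
      have := congrFun (congrFun hW j) j
      rw [Matrix.one_apply_eq, Matrix.mul_apply] at this
      rw [← this, Matrix.trace]
      exact Finset.sum_congr rfl fun p _ => mul_comm _ _
    rw [h2, Complex.one_re] at h1
    rw [trace_maxEntangled_mul, abs_mul, abs_of_nonneg (by positivity)]
    exact mul_le_of_le_one_right (by positivity) h1
  have h : (maxEntangled k * N M).trace.re = ∑ j, d j * (maxEntangled k * N (Z j)).trace.re := by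
    rw [hM', map_sum, Matrix.mul_sum, Matrix.trace_sum, Complex.re_sum]
    refine Finset.sum_congr rfl fun j _ => ?_
    rw [map_smul, Matrix.mul_smul, Matrix.trace_smul, smul_eq_mul, Complex.re_ofReal_mul]
  rw [h, Finset.mul_sum]
  refine Finset.sum_le_sum fun j _ => (le_abs_self _).trans ?_
  rw [abs_mul, mul_comm]
  exact mul_le_mul_of_nonneg_right (hZ j) (abs_nonneg _)

/-- One-shot converse: a Nussbaum–Szkoła bound on the fidelity of PPT distillation. -/
lemma sum_min_le_of_pptOperation {A B J K L : Type*} [Fintype A] [DecidableEq A] [Fintype B]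
    [DecidableEq B] [Fintype J] [DecidableEq J] [Fintype K] [DecidableEq K] [Fintype L]
    [DecidableEq L] {k : ℕ}
    {N : Matrix (A × B) (A × B) ℂ →ₗ[ℂ] Matrix (Fin k × Fin k) (Fin k × Fin k) ℂ}
    (hN : IsPPTOperation N) {X : Matrix (A × B) J ℂ} {Y : Matrix (A × B) K ℂ}
    {W : Matrix (A × B) L ℂ} (hX : X * Xᴴ = 1) (hX' : Xᴴ * X = 1) (hY : Y * Yᴴ = 1)
    (hW : Wᴴ * W = 1) {a : J → ℝ} {b : K → ℝ} {d : L → ℝ} (ha : ∀ j, 0 ≤ a j) (hb : ∀ j, 0 ≤ b j)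
    (hd : partialTranspose (spectralMatrix Y b) = spectralMatrix W d) (hd1 : ∑ l, |d l| ≤ 1)
    {c : ℝ} (hc : 0 ≤ c) :
    ∑ j, ∑ l, min (a j) (c * b l) * Complex.normSq ((Xᴴ * Y) j l)
      ≤ 2 * (∑ j, a j - (maxEntangled k * N (spectralMatrix X a)).trace.re + c / k) := by
  have hT : (adjointEffect N (maxEntangled k)).PosSemidef := by
    rw [maxEntangled_eq_conjTranspose_mul_self]
    exact adjointEffect_posSemidef hN.2.1 _
  have hT1 : (1 - adjointEffect N (maxEntangled k)).PosSemidef := by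
    rw [← adjointEffect_one_sub hN.1, one_sub_maxEntangled_eq_conjTranspose_mul_self]
    exact adjointEffect_posSemidef hN.2.1 _
  refine (sum_min_le_test_errors hT hT1 hX hY ha fun l => mul_nonneg hc (hb l)).trans ?_
  have h1 : (adjointEffect N (maxEntangled k) * spectralMatrix Y (fun l => c * b l)).trace.re
      = c * (maxEntangled k * N (spectralMatrix Y b)).trace.re := by
    rw [← trace_adjointEffect_mul, trace_mul_spectralMatrix, trace_mul_spectralMatrix,
      Finset.mul_sum]
    exact Finset.sum_congr rfl fun l _ => by ring
  have h2 := trace_maxEntangled_pptOperation_le hN hW hd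
  have h3 : (1 / k : ℝ) * ∑ l, |d l| ≤ 1 / k := mul_le_of_le_one_right (by positivity) hd1
  have h4 := mul_le_mul_of_nonneg_left (h2.trans h3) hc
  rw [h1, Matrix.sub_mul, Matrix.trace_sub, Complex.sub_re, trace_adjointEffect_mul,
    Matrix.one_mul, trace_spectralMatrix hX', div_eq_mul_one_div c]
  linarith

/-! ### Classical Chernoff bound -/

/-- Markov's inequality for (a/b)^s, termwise: if a ≥ cb > 0 then (a/(cb))^s ≥ 1 and the left side
is nonpositive. The hypothesis `h` deals with b = 0, where a / b is 0 by convention. -/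
lemma sub_rpow_le_min {a b w c s : ℝ} (ha : 0 ≤ a) (hb : 0 ≤ b) (hw : 0 ≤ w) (hc : 0 < c)
    (hs : 0 ≤ s) (h : b = 0 → a * w = 0) :
    a * w - c ^ (-s) * (a * w * (a / b) ^ s) ≤ min a (c * b) * w := by
  rcases hb.eq_or_lt with rfl | hb
  · simp [h rfl, ha]
  · rcases le_total a (c * b) with hab | hab
    · rw [min_eq_left hab]
      have : 0 ≤ c ^ (-s) * (a * w * (a / b) ^ s) := by positivity
      linarith
    · have h1 : c ^ s ≤ (a / b) ^ s :=
        Real.rpow_le_rpow hc.le ((le_div_iff₀ hb).2 hab) hs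
      have h2 : 1 ≤ c ^ (-s) * (a / b) ^ s := by
        rw [Real.rpow_neg hc.le, ← div_eq_inv_mul, le_div_iff₀ (by positivity), one_mul]
        exact h1
      have h3 : 0 ≤ min a (c * b) * w := by positivity
      have h4 : 0 ≤ a * w := by positivity
      nlinarith

lemma sum_sum_prod_eq_pow {J K : Type*} [Fintype J] [Fintype K] (h : J → K → ℝ) (n : ℕ) :
    ∑ f : Fin n → J, ∑ g : Fin n → K, ∏ i, h (f i) (g i) = (∑ j, ∑ k, h j k) ^ n := by
  classical
  simp only [← Fintype.prod_sum]
  rw [← Fintype.prod_sum fun (_ : Fin n) j => ∑ k, h j k, Finset.prod_const, Finset.card_univ,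
    Fintype.card_fin]

/-- A Chernoff bound for the likelihood ratio of product weights. -/
lemma one_sub_pow_le_sum_min {J K : Type*} [Fintype J] [Fintype K] {a : J → ℝ} {b : K → ℝ}
    {w : J → K → ℝ} (ha : ∀ j, 0 ≤ a j) (hb : ∀ k, 0 ≤ b k) (hw : ∀ j k, 0 ≤ w j k)
    (hsupp : ∀ j k, b k = 0 → a j * w j k = 0) (hsum : ∑ j, ∑ k, a j * w j k = 1)
    {c s : ℝ} (hc : 0 < c) (hs : 0 ≤ s) (n : ℕ) :
    1 - (c ^ (-s) * ∑ j, ∑ k, a j * w j k * (a j / b k) ^ s) ^ n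
      ≤ ∑ f : Fin n → J, ∑ g : Fin n → K,
        min (∏ i, a (f i)) (c ^ n * ∏ i, b (g i)) * ∏ i, w (f i) (g i) := by
  have h1 : ∀ (f : Fin n → J) (g : Fin n → K),
      (∏ i, a (f i) * w (f i) (g i))
        - c ^ (-s * n) * ∏ i, (a (f i) * w (f i) (g i) * (a (f i) / b (g i)) ^ s)
      ≤ min (∏ i, a (f i)) (c ^ n * ∏ i, b (g i)) * ∏ i, w (f i) (g i) := by
    intro f g
    have := sub_rpow_le_min (a := ∏ i, a (f i)) (b := ∏ i, b (g i)) (w := ∏ i, w (f i) (g i))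
      (c := c ^ n) (s := s) (Finset.prod_nonneg fun i _ => ha _)
      (Finset.prod_nonneg fun i _ => hb _) (Finset.prod_nonneg fun i _ => hw _ _)
      (by positivity) hs (fun h => by
        obtain ⟨i, -, hi⟩ := Finset.prod_eq_zero_iff.1 h
        rw [← Finset.prod_mul_distrib]
        exact Finset.prod_eq_zero (Finset.mem_univ i) (hsupp _ _ hi))
    rw [Finset.prod_mul_distrib, Finset.prod_mul_distrib, Finset.prod_mul_distrib,
      Real.finsetProd_rpow _ _ (fun i _ => div_nonneg (ha _) (hb _)), Finset.prod_div_distrib]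
    convert this using 3
    rw [← Real.rpow_natCast c n, ← Real.rpow_mul hc.le]
    congr 1
    ring
  refine le_trans (le_of_eq ?_) (Finset.sum_le_sum fun f _ => Finset.sum_le_sum fun g _ => h1 f g)
  simp only [Finset.sum_sub_distrib, ← Finset.mul_sum]
  rw [sum_sum_prod_eq_pow (fun j k => a j * w j k), hsum, one_pow,
    sum_sum_prod_eq_pow (fun j k => a j * w j k * (a j / b k) ^ s), mul_pow,
    Real.rpow_mul hc.le, Real.rpow_natCast]

/-- Both sides equal 1 at s = 0, and there the right side has the larger derivative. -/
lemma exists_sum_rpow_lt_exp {ι : Type*} [Fintype ι] {P r : ι → ℝ} (hr : ∀ i, P i ≠ 0 → 0 < r i)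
    (hsum : ∑ i, P i = 1) {E : ℝ} (hE : ∑ i, P i * Real.log (r i) < E) :
    ∃ s > 0, ∑ i, P i * r i ^ s < Real.exp (s * E) := by
  have hder : HasDerivAt (fun s : ℝ => Real.exp (s * E) - ∑ i, P i * r i ^ s)
      (E - ∑ i, P i * Real.log (r i)) 0 := by
    refine HasDerivAt.sub ?_ ?_
    · have := ((hasDerivAt_id (0 : ℝ)).mul_const E).exp
      simpa using this
    · refine HasDerivAt.fun_sum fun i _ => ?_
      by_cases hi : P i = 0
      · simpa [hi] using hasDerivAt_const (0 : ℝ) (0 : ℝ)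
      · have := ((hasDerivAt_id (0 : ℝ)).const_rpow (hr i hi)).const_mul (P i)
        simpa using this
  have h := hder.tendsto_slope_zero_right.eventually (lt_mem_nhds (sub_pos.2 hE))
  obtain ⟨s, h1, hs⟩ := (h.and self_mem_nhdsWithin).exists
  have hs : 0 < s := hs
  refine ⟨s, hs, ?_⟩
  simp only [zero_add, zero_mul, Real.exp_zero, Real.rpow_zero, mul_one, hsum, sub_self,
    sub_zero, smul_eq_mul] at h1
  exact sub_pos.1 ((pos_iff_pos_of_mul_pos h1).1 (inv_pos.2 hs))

/-! ### Relative entropy in terms of the classical weights -/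

/-- If b_k = 0 then y_k lies in both kernels, and pairing with x_j gives a_j⟨x_j|y_k⟩ = 0. This is
absolute continuity of the classical weights. -/
lemma mul_normSq_eq_zero_of_ker_le {I J K : Type*} [Fintype I] [Fintype J] [DecidableEq J]
    [Fintype K] [DecidableEq K] {X : Matrix I J ℂ} {Y : Matrix I K ℂ} (hX : Xᴴ * X = 1)
    (hY : Yᴴ * Y = 1) {a : J → ℝ} {b : K → ℝ}
    (h : ∀ v : I → ℂ, spectralMatrix Y b *ᵥ v = 0 → spectralMatrix X a *ᵥ v = 0)
    {j : J} {k : K} (hk : b k = 0) : a j * Complex.normSq ((Xᴴ * Y) j k) = 0 := by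
  have h1 : spectralMatrix Y b *ᵥ (Y *ᵥ Pi.single k 1) = 0 := by
    rw [Matrix.mulVec_mulVec, spectralMatrix, Matrix.mul_assoc, hY, Matrix.mul_one,
      ← Matrix.mulVec_mulVec]
    simp [hk]
  have h2 := congrFun (congrArg (fun v => Xᴴ *ᵥ v) (h _ h1)) j
  simp only [Matrix.mulVec_zero, Pi.zero_apply, Matrix.mulVec_mulVec, spectralMatrix] at h2
  have h3 : Xᴴ * (X * Matrix.diagonal (fun j => (a j : ℂ)) * Xᴴ) * Y
      = Xᴴ * X * (Matrix.diagonal (fun j => (a j : ℂ)) * (Xᴴ * Y)) := by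
    simp only [Matrix.mul_assoc]
  rw [← Matrix.mul_assoc, h3, hX, Matrix.one_mul,
    Matrix.mulVec_single_one, Matrix.col_apply, Matrix.diagonal_mul] at h2
  rcases mul_eq_zero.1 h2 with h4 | h4
  · simp [Complex.ofReal_eq_zero.1 h4]
  · simp [h4]

lemma sum_mul_normSq {I J K : Type*} [Fintype I] [DecidableEq I] [Fintype J] [DecidableEq J]
    [Fintype K] {X : Matrix I J ℂ} {Y : Matrix I K ℂ} (hX : Xᴴ * X = 1) (hY : Y * Yᴴ = 1)
    (a : J → ℝ) : ∑ j, ∑ k, a j * Complex.normSq ((Xᴴ * Y) j k) = ∑ j, a j := by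
  refine Finset.sum_congr rfl fun j _ => ?_
  have : Xᴴ * Y * (Xᴴ * Y)ᴴ = 1 := by
    rw [Matrix.conjTranspose_mul, Matrix.conjTranspose_conjTranspose, Matrix.mul_assoc,
      ← Matrix.mul_assoc Y, hY, Matrix.one_mul, hX]
  rw [← Finset.mul_sum, ← mul_conjTranspose_apply_self_re, this]
  simp

/-- The relative entropy is that of the Nussbaum–Szkoła weights. -/
lemma relEntropy_eq_sum {I J K : Type*} [Fintype I] [DecidableEq I] [Fintype J] [DecidableEq J]
    [Fintype K] [DecidableEq K] {X : Matrix I J ℂ} {Y : Matrix I K ℂ} (hX : Xᴴ * X = 1)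
    (hY : Y * Yᴴ = 1) (a : J → ℝ) (b : K → ℝ) (f : ℝ → ℝ) :
    (spectralMatrix X a * (spectralMatrix X (fun j => f (a j))
      - spectralMatrix Y (fun k => f (b k)))).trace.re
      = ∑ j, ∑ k, a j * Complex.normSq ((Xᴴ * Y) j k) * (f (a j) - f (b k)) := by
  have h1 : (spectralMatrix X a * spectralMatrix X (fun j => f (a j))).trace.re
      = ∑ j, a j * f (a j) := by
    rw [trace_spectralMatrix_mul, hX]
    simp [Matrix.one_apply, apply_ite Complex.normSq]
  rw [Matrix.mul_sub, Matrix.trace_sub, Complex.sub_re, h1, trace_spectralMatrix_mul,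
    ← sum_mul_normSq hX hY]
  simp only [← Finset.sum_sub_distrib]
  exact Finset.sum_congr rfl fun j _ => Finset.sum_congr rfl fun k _ => by ring

/-! ### Asymptotic converse -/

lemma oneShotDistillable_le {A B : Type*} [Fintype A] [DecidableEq A] [Fintype B] [DecidableEq B]
    {ε : ℝ} {ρ : Matrix (A × B) (A × B) ℂ} {R : ℝ}
    (h : ∀ k : ℕ, 1 ≤ k → 1 - ε ≤ pptFidelity ρ k → Real.logb 2 k ≤ R) :
    oneShotDistillable ε ρ ≤ R :=
  iSup₂_le fun k hk => EReal.coe_le_coe_iff.2 (h k hk.1 hk.2)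

/-- A strict inequality avoids having to attain the supremum; 0 ≤ t excludes the empty set, whose
`sSup` is 0. -/
lemma exists_pptOperation_of_lt_pptFidelity {A B : Type*} [Fintype A] [DecidableEq A] [Fintype B]
    [DecidableEq B] {ρ : Matrix (A × B) (A × B) ℂ} {k : ℕ} {t : ℝ} (ht : 0 ≤ t)
    (h : t < pptFidelity ρ k) :
    ∃ N : Matrix (A × B) (A × B) ℂ →ₗ[ℂ] Matrix (Fin k × Fin k) (Fin k × Fin k) ℂ,
      IsPPTOperation N ∧ t < (maxEntangled k * N ρ).trace.re := by
  rcases Set.eq_empty_or_nonempty {f : ℝ | ∃ N : Matrix (A × B) (A × B) ℂ →ₗ[ℂ]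
      Matrix (Fin k × Fin k) (Fin k × Fin k) ℂ,
    IsPPTOperation N ∧ f = (maxEntangled k * N ρ).trace.re} with hE | hE
  · rw [pptFidelity, hE, Real.sSup_empty] at h
    exact absurd h ht.not_gt
  · obtain ⟨f, ⟨N, hN, rfl⟩, hf⟩ := exists_lt_of_lt_csSup hE h
    exact ⟨N, hN, hf⟩

lemma partialTranspose_isHermitian {A B : Type*} {M : Matrix (A × B) (A × B) ℂ}
    (hM : M.IsHermitian) : (partialTranspose M).IsHermitian := by
  ext p q
  exact hM.apply _ _

/-- The asymptotic converse for rates above the relative entropy to a member of the Rains set. -/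
lemma eventually_logb_le {A B : Type*} [Fintype A] [DecidableEq A] [Fintype B] [DecidableEq B]
    {ρ σ : Matrix (A × B) (A × B) ℂ} (hρ : IsState ρ) (hσ : σ ∈ rainsSet A B) {R : ℝ}
    (hR : relEntropy ρ σ < R) :
    ∀ᶠ n : ℕ in Filter.atTop, ∀ ε : ℝ, ε < 1 / 4 → ∀ k : ℕ, 1 ≤ k →
      1 - ε ≤ pptFidelity (tensorPower ρ n) k → Real.logb 2 k ≤ 3 + n * R := by
  obtain ⟨hσ0, hσ1⟩ := hσ
  obtain ⟨X, a, hX, hX', hρX, hρf, ha⟩ := exists_spectralMatrix hρ.1.isHermitian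
  obtain ⟨Y, b, hY, hY', hσY, hσf, hb⟩ := exists_spectralMatrix hσ0.isHermitian
  obtain ⟨W, d, hW, hW', hσW, hd⟩ :=
    exists_spectralMatrix_traceNorm (partialTranspose_isHermitian hσ0.isHermitian)
  replace ha := ha hρ.1
  replace hb := hb hσ0
  rw [hd] at hσ1
  have hker : ∀ v, σ *ᵥ v = 0 → ρ *ᵥ v = 0 := by
    by_contra hc
    rw [relEntropy, if_neg hc] at hR
    exact not_top_lt hR
  rw [relEntropy, if_pos hker, hρf, hσf, EReal.coe_lt_coe_iff, hρX] at hR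
  rw [relEntropy_eq_sum hX' hY] at hR
  have hsupp : ∀ j k, b k = 0 → a j * Complex.normSq ((Xᴴ * Y) j k) = 0 := fun j k hk =>
    mul_normSq_eq_zero_of_ker_le hX' hY' (by rwa [← hρX, ← hσY]) hk
  have hsuma : ∑ j, a j = 1 := by
    have := congrArg Complex.re hρ.2
    rwa [hρX, trace_spectralMatrix hX', Complex.one_re] at this
  have hsum := (sum_mul_normSq hX' hY a).trans hsuma
  have hlog2 : 0 < Real.log 2 := Real.log_pos one_lt_two
  obtain ⟨s, hs, hlt⟩ : ∃ s > 0, ∑ i : (A × B) × (A × B),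
      a i.1 * Complex.normSq ((Xᴴ * Y) i.1 i.2) * (a i.1 / b i.2) ^ s
        < Real.exp (s * (R * Real.log 2)) := by
    have hpos : ∀ i : (A × B) × (A × B), a i.1 * Complex.normSq ((Xᴴ * Y) i.1 i.2) ≠ 0 →
        0 < a i.1 ∧ 0 < b i.2 := fun i hi =>
      ⟨(ha _).lt_of_ne fun h => hi (by rw [← h, zero_mul]),
        (hb _).lt_of_ne fun h => hi (hsupp _ _ h.symm)⟩
    refine exists_sum_rpow_lt_exp (fun i hi => div_pos (hpos i hi).1 (hpos i hi).2)
      (by rw [Fintype.sum_prod_type]; exact hsum) ?_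
    rw [← div_lt_iff₀ hlog2, Finset.sum_div, Fintype.sum_prod_type]
    refine lt_of_eq_of_lt ?_ hR
    refine Finset.sum_congr rfl fun j _ => Finset.sum_congr rfl fun k _ => ?_
    by_cases hi : a j * Complex.normSq ((Xᴴ * Y) j k) = 0
    · simp [hi]
    · have := hpos (j, k) hi
      rw [Real.log_div this.1.ne' this.2.ne', Real.logb, Real.logb]
      ring
  -- The likelihood threshold per copy; q < 1 below restates the choice of s.
  set c : ℝ := 2 ^ R with hc_def
  have hc : 0 < c := Real.rpow_pos_of_pos two_pos R
  rw [Fintype.sum_prod_type] at hlt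
  set q : ℝ := c ^ (-s) * ∑ j, ∑ k, a j * Complex.normSq ((Xᴴ * Y) j k) * (a j / b k) ^ s
    with hq_def
  have hq0 : 0 ≤ q := by
    refine mul_nonneg (by positivity) (Finset.sum_nonneg fun j _ => Finset.sum_nonneg fun k _ => ?_)
    exact mul_nonneg (mul_nonneg (ha _) (Complex.normSq_nonneg _))
      (Real.rpow_nonneg (div_nonneg (ha _) (hb _)) _)
  have hq1 : q < 1 := by
    have hexp : Real.exp (s * (R * Real.log 2)) = c ^ s := by
      rw [hc_def, ← Real.rpow_mul zero_le_two, Real.rpow_def_of_pos two_pos]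
      congr 1
      ring
    rw [hexp] at hlt
    rw [hq_def, Real.rpow_neg hc.le, ← div_eq_inv_mul, div_lt_one (by positivity)]
    exact hlt
  filter_upwards [(tendsto_pow_atTop_nhds_zero_of_lt_one hq0 hq1).eventually
    (gt_mem_nhds (show (0 : ℝ) < 1 / 4 by norm_num))] with n hn ε hε k hk hF
  obtain ⟨N, hN, hf⟩ := exists_pptOperation_of_lt_pptFidelity (t := 3 / 4) (by norm_num)
    (lt_of_lt_of_le (by linarith) hF)
  have h1 := one_sub_pow_le_sum_min ha hb (fun j k => Complex.normSq_nonneg _) hsupp hsum hc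
    hs.le n
  rw [← hq_def] at h1
  have h2 := sum_min_le_of_pptOperation (X := powBasis X n) (Y := powBasis Y n)
    (W := powBasis W n) (a := fun f => ∏ i, a (f i)) (b := fun f => ∏ i, b (f i))
    (d := fun f => ∏ i, d (f i)) (c := c ^ n) hN (powBasis_mul_conjTranspose hX n)
    (conjTranspose_powBasis_mul hX' n)
    (powBasis_mul_conjTranspose hY n) (conjTranspose_powBasis_mul hW' n)
    (fun f => Finset.prod_nonneg fun i _ => ha _)
    (fun f => Finset.prod_nonneg fun i _ => hb _)
    (by rw [← tensorPower_spectralMatrix, ← hσY, partialTranspose_tensorPower, hσW,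
          tensorPower_spectralMatrix])
    (by
      simp only [Finset.abs_prod]
      rw [← Fintype.prod_sum fun (_ : Fin n) l => |d l|]
      exact Finset.prod_le_one (fun i _ => Finset.sum_nonneg fun _ _ => abs_nonneg _)
        fun i _ => hσ1) (by positivity)
  rw [← tensorPower_spectralMatrix, ← hρX, ← Fintype.prod_sum fun (_ : Fin n) j => a j, hsuma,
    Finset.prod_const_one] at h2
  simp only [conjTranspose_powBasis_mul_apply, map_prod] at h2
  have hk0 : (0 : ℝ) < k := by exact_mod_cast hk
  -- From q^n < 1/4 and fidelity above 3/4: 3/4 ≤ 2(1/4 + c^n/k).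
  have h3 : (k : ℝ) ≤ 8 * c ^ n := by
    have : 1 / 8 ≤ c ^ n / k := by linarith
    rw [le_div_iff₀ hk0] at this
    linarith
  have h4 : (8 * c ^ n : ℝ) = 2 ^ (3 + n * R : ℝ) := by
    rw [Real.rpow_add two_pos, mul_comm (n : ℝ), Real.rpow_mul zero_le_two, Real.rpow_natCast, ← hc_def]
    norm_num
  rw [Real.logb_le_iff_le_rpow one_lt_two hk0, ← h4]
  exact h3

end Entanglement

theorem corollary1 {A B : Type*} [Fintype A] [DecidableEq A] [Fintype B] [DecidableEq B]
    (ρ : Matrix (A × B) (A × B) ℂ) (hρ : Entanglement.IsState ρ) :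
    Entanglement.pptDistillable ρ ≤ Entanglement.rainsBound ρ := by
  refine le_iInf₂ fun σ hσ => ?_
  refine EReal.le_of_forall_lt_iff_le.1 fun R hR => ?_
  -- The gap R - R' absorbs the additive constant: 3 ≤ n(R - R') for n > m.
  obtain ⟨R', hR', hRR'⟩ := EReal.lt_iff_exists_real_btwn.1 hR
  rw [EReal.coe_lt_coe_iff] at hRR'
  have h1 := Entanglement.eventually_logb_le hρ hσ hR'
  obtain ⟨m, hm⟩ := exists_nat_gt (3 / (R - R'))
  refine Filter.limsup_le_of_le (h := ?_)
  have hε : ∀ᶠ ε : ℝ in nhdsWithin 0 (Set.Ioi 0), ε < 1 / 4 :=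
    nhdsWithin_le_nhds (gt_mem_nhds (by norm_num))
  filter_upwards [hε] with ε hε
  refine Filter.limsup_le_of_le (h := ?_)
  filter_upwards [h1, Filter.eventually_ge_atTop (m + 1)] with n hn hmn
  have hn0 : (0 : ℝ) < n := by exact_mod_cast (Nat.succ_pos m).trans_le hmn
  have hmn' : (m : ℝ) ≤ n := by exact_mod_cast (Nat.le_succ m).trans hmn
  refine (EReal.div_le_iff_le_mul (by exact_mod_cast hn0) (EReal.natCast_ne_top n)).2 ?_
  refine (Entanglement.oneShotDistillable_le fun k hk hF => (hn ε hε k hk hF).trans ?_ :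
    _ ≤ (((n : ℝ) * R : ℝ) : EReal)).trans ?_
  · rw [div_lt_iff₀ (sub_pos.2 hRR')] at hm
    nlinarith
  · rw [EReal.coe_mul]
    exact le_of_eq (by norm_cast)
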